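/- Let $E$ be a compact metric space, and let $\{S(t)\}_{t\ge 0}$ be a strongly continuous semigroup of positive linear operators on $(C(E),\|\cdot\|_\infty)$ with $S(t)1=1$ (the transition semigroup of a Feller process on $E$), with infinitesimal generator $(A,\mathcal D(A))$. Put $V(t)f=\log S(t)e^f$. Let $D\subseteq\mathcal D(A)$ be a core for $A$ that is a linear subspace, is dense in $C(E)$, is closed under products, and satisfies $\phi\circ f\in D$ whenever $f\in D$ and $\phi$ is smooth on a neighbourhood of the range of $f$. For $f\in D$ put $Hf=e^{-f}A e^{f}$. Suppose that $D$ carries a topology $\tau_D$ such that: (a) $(D,\tau_D)$ is a separable barrelled locally convex Hausdorff space; (b) $\tau_D$ is finer than the sup norm topology; (c) $f\mapsto e^f-1$ and $(f,g)\mapsto fg$ are $\tau_D$-continuous maps $D\to D$ and $D\times D\to D$; (d) $S(t)D\subseteq D$ and $V(t)D\subseteq D$ for all $t\ge0$, and the restrictions of both semigroups to $D$ are strongly continuous for $\tau_D$, i.e. each $S(t)$ and each $V(t)$ is $\tau_D$-continuous on $D$, and $t\mapsto S(t)f$ and $t\mapsto V(t)f$ are $\tau_D$-continuous for every $f\in D$;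 (e) $A:(D,\tau_D)\to(C(E),\|\cdot\|_\infty)$ is continuous; (f) there is a barrel (a closed, convex, balanced, absorbing set) $\mathcal N\subseteq D$ with $\sup_{f\in\mathcal N}\|Hf\|\le 1$ and $\sup_{f\in c\mathcal N}\|Hf\|<\infty$ for every $c>0$. Let $\mathcal P(E)$ be the space of Borel probability measures on $E$ with the weak topology, let $D'$ be the continuous dual of $(D,\tau_D)$, and define $\mathcal L:\mathcal P(E)\times D'\to[0,\infty]$ by $$\mathcal L(\mu,u)=\sup_{f\in D}\Big\{\langle f,u\rangle-\int Hf\,d\mu\Big\}.$$ A continuous path $\mu:[0,\infty)\to\mathcal P(E)$ is called absolutely continuous, $\mu\in\mathcal{AC}$, if there is a weak* measurable $u:[0,\infty)\to D'$ such that for all $f\in D$ and $t\ge0$ one has $\int_0^t|\langle f,u(s)\rangle|\,ds<\infty$ and $\int f\,d\mu(t)-\int f\,d\mu(0)=\int_0^t\langle f,u(s)\rangle\,ds$; such a $u$ is unique up to a Lebesgue null set and is denoted $\dot\mu$. Then for every $M>0$ and $T\ge0$, the set of restrictions to $[0,T]$ of the paths in $$\Big\{\mu\in C([0,\infty),\mathcal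 P(E))\ \Big|\ \mu\in\mathcal{AC},\ \int_0^T\mathcal L(\mu(s),\dot\mu(s))\,ds\le M\Big\}$$ is a compact subset of $C([0,T],\mathcal P(E))$ with the topology of uniform convergence. -/

import Mathlib

open MeasureTheory Filter Topology Set
open scoped NNReal ENNReal ContDiff Pointwise

namespace PathLD

noncomputable section

/-- A conservative Feller semigroup on a compact space `E`: a strongly continuous semigroup of
positive operators on `C(E)` which preserve the constant function `1`. -/
structure FellerSemigroup (E : Type*) [TopologicalSpace E] [CompactSpace E] where
  /-- the operator `S(t)` -/
  op : ℝ≥0 → C(E, ℝ) →L[ℝ] C(E, ℝ)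
  op_zero : op 0 = ContinuousLinearMap.id ℝ C(E, ℝ)
  op_add : ∀ s t, op (s + t) = (op s).comp (op t)
  op_nonneg : ∀ t f, 0 ≤ f → 0 ≤ op t f
  op_one : ∀ t, op t 1 = 1
  continuous_orbit : ∀ f, Continuous fun t => op t f

/-- The function `x ↦ e ^ f(x)`. -/
def expC {E : Type*} [TopologicalSpace E] (f : C(E, ℝ)) : C(E, ℝ) :=
  ⟨fun x => Real.exp (f x), by fun_prop⟩

namespace FellerSemigroup

variable {E : Type*} [TopologicalSpace E] [CompactSpace E] (S : FellerSemigroup E)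

/-- The domain `𝒟(A)` of the infinitesimal generator: those `f` for which
`(S(t) f - f) / t` converges in sup norm as `t ↓ 0`. -/
def domain : Set C(E, ℝ) :=
  {f | DifferentiableWithinAt ℝ (fun t : ℝ => S.op t.toNNReal f) (Ici 0) 0}

/-- The infinitesimal generator, `A f = lim_{t ↓ 0} (S(t) f - f) / t`; meaningful on `domain`. -/
def generator (f : C(E, ℝ)) : C(E, ℝ) :=
  derivWithin (fun t : ℝ => S.op t.toNNReal f) (Ici 0) 0

/-- The Hamiltonian `H f = e ^ (-f) A e ^ f`; meaningful when `e ^ f` is in `domain`. -/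
def hamiltonian (f : C(E, ℝ)) : C(E, ℝ) :=
  expC (-f) * S.generator (expC f)

theorem op_expC_pos (t : ℝ≥0) (f : C(E, ℝ)) (x : E) : 0 < S.op t (expC f) x := by
  have h : 0 ≤ expC f - Real.exp (-‖f‖) • (1 : C(E, ℝ)) := by
    intro y
    have h1 : -‖f‖ ≤ f y := by
      have := f.norm_coe_le_norm y
      rw [Real.norm_eq_abs] at this
      exact (abs_le.mp this).1
    have h2 := Real.exp_le_exp.mpr h1
    simpa [expC] using h2
  have h3 := S.op_nonneg t _ h x
  rw [map_sub, map_smul, S.op_one] at h3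
  have h4 : Real.exp (-‖f‖) ≤ S.op t (expC f) x := by simpa using h3
  exact (Real.exp_pos _).trans_le h4

/-- The nonlinear semigroup `V(t) f = log (S(t) e ^ f)`. -/
def logOp (t : ℝ≥0) (f : C(E, ℝ)) : C(E, ℝ) :=
  ⟨fun x => Real.log (S.op t (expC f) x),
    (S.op t (expC f)).continuous.log fun x => (S.op_expC_pos t f x).ne'⟩

theorem hamiltonian_zero : S.hamiltonian 0 = 0 := by
  have h : expC (0 : C(E, ℝ)) = 1 := by ext x; simp [expC]
  simp [hamiltonian, generator, h, S.op_one]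

end FellerSemigroup

/-- `D` is a core for the generator `A`, is dense in `C(E)`, is closed under products, and is closed
under composition with functions that are smooth on a neighbourhood of the range. -/
structure IsSmoothCore {E : Type*} [TopologicalSpace E] [CompactSpace E] (S : FellerSemigroup E)
    (D : Submodule ℝ C(E, ℝ)) : Prop where
  mem_domain : ∀ f ∈ D, f ∈ S.domain
  dense : Dense (D : Set C(E, ℝ))
  core : ∀ f ∈ S.domain, ∃ g : ℕ → C(E, ℝ), (∀ n, g n ∈ D) ∧ Tendsto g atTop (𝓝 f) ∧
    Tendsto (fun n => S.generator (g n)) atTop (𝓝 (S.generator f))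
  mul_mem : ∀ f ∈ D, ∀ g ∈ D, f * g ∈ D
  comp_mem : ∀ f ∈ D, ∀ φ : ℝ → ℝ, ∀ V : Set ℝ, IsOpen V → range f ⊆ V → ContDiffOn ℝ ∞ φ V →
    ∀ g : C(E, ℝ), (∀ x, g x = φ (f x)) → g ∈ D

theorem IsSmoothCore.exp_sub_one_mem {E : Type*} [TopologicalSpace E] [CompactSpace E]
    {S : FellerSemigroup E} {D : Submodule ℝ C(E, ℝ)} (h : IsSmoothCore S D) {f : C(E, ℝ)}
    (hf : f ∈ D) : expC f - 1 ∈ D :=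
  h.comp_mem f hf (fun r => Real.exp r - 1) univ isOpen_univ (subset_univ _)
    (Real.contDiff_exp.sub contDiff_const).contDiffOn _ fun x => by simp [expC]

/-- The vector space `D ⊆ C(E)` without the topology inherited from the sup norm, so that it can
carry a topology `τ_D` of its own. -/
def CoreSpace {E : Type*} [TopologicalSpace E] (D : Submodule ℝ C(E, ℝ)) : Type _ := D

namespace CoreSpace

variable {E : Type*} [TopologicalSpace E] (D : Submodule ℝ C(E, ℝ))

instance : AddCommGroup (CoreSpace D) := inferInstanceAs (AddCommGroup D)

instance : Module ℝ (CoreSpace D) := inferInstanceAs (Module ℝ D)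

variable {D}

/-- The inclusion `D → C(E)`. -/
def incl : CoreSpace D →ₗ[ℝ] C(E, ℝ) := D.subtype

/-- An element of `D` as an element of `CoreSpace D`. -/
def mk (f : C(E, ℝ)) (hf : f ∈ D) : CoreSpace D := (⟨f, hf⟩ : D)

theorem incl_mem (f : CoreSpace D) : incl f ∈ D := Subtype.property (p := (· ∈ D)) f

@[simp] theorem incl_mk (f : C(E, ℝ)) (hf : f ∈ D) : incl (mk f hf) = f := rfl

end CoreSpace

open CoreSpace

/-- The conditions on the core `D` and on its topology `τ_D`, apart from `(D, τ_D)` being a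
separable barrelled locally convex Hausdorff space. -/
structure IsRegularCore {E : Type*} [TopologicalSpace E] [CompactSpace E] (S : FellerSemigroup E)
    (D : Submodule ℝ C(E, ℝ)) [TopologicalSpace (CoreSpace D)] : Prop extends
    IsSmoothCore S D where
  /-- `τ_D` is finer than the sup norm topology -/
  continuous_incl : Continuous fun f : CoreSpace D => incl f
  /-- `f ↦ e ^ f - 1` is `τ_D`-continuous -/
  continuous_exp : Continuous fun f : CoreSpace D =>
    CoreSpace.mk (expC (incl f) - 1) (toIsSmoothCore.exp_sub_one_mem (incl_mem f))
  /-- multiplication is `τ_D`-continuous -/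
  continuous_mul : Continuous fun p : CoreSpace D × CoreSpace D =>
    CoreSpace.mk (incl p.1 * incl p.2) (toIsSmoothCore.mul_mem _ (incl_mem p.1) _ (incl_mem p.2))
  /-- `S(t)` and `V(t)` map `D` to itself and restrict to strongly continuous semigroups on
  `(D, τ_D)` -/
  op_mem : ∀ t, ∀ f ∈ D, S.op t f ∈ D
  continuous_op : ∀ t, Continuous fun f : CoreSpace D =>
    CoreSpace.mk (S.op t (incl f)) (op_mem t _ (incl_mem f))
  continuous_op_orbit : ∀ f : CoreSpace D, Continuous fun t : ℝ≥0 =>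
    CoreSpace.mk (S.op t (incl f)) (op_mem t _ (incl_mem f))
  logOp_mem : ∀ t, ∀ f ∈ D, S.logOp t f ∈ D
  continuous_logOp : ∀ t, Continuous fun f : CoreSpace D =>
    CoreSpace.mk (S.logOp t (incl f)) (logOp_mem t _ (incl_mem f))
  continuous_logOp_orbit : ∀ f : CoreSpace D, Continuous fun t : ℝ≥0 =>
    CoreSpace.mk (S.logOp t (incl f)) (logOp_mem t _ (incl_mem f))
  /-- `A : (D, τ_D) → C(E)` is continuous -/
  continuous_generator : Continuous fun f : CoreSpace D => S.generator (incl f)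
  /-- there is a barrel on which `‖H f‖ ≤ 1` and on whose multiples `‖H f‖` is bounded -/
  exists_barrel : ∃ N : Set (CoreSpace D),
    Convex ℝ N ∧ Balanced ℝ N ∧ Absorbent ℝ N ∧ IsClosed N ∧
    (∀ f ∈ N, ‖S.hamiltonian (incl f)‖ ≤ 1) ∧
    ∀ c : ℝ, 0 < c → ∃ B : ℝ, ∀ f ∈ c • N, ‖S.hamiltonian (incl f)‖ ≤ B

section Paths

variable {E : Type*} [TopologicalSpace E] [MeasurableSpace E] {D : Submodule ℝ C(E, ℝ)}
  [TopologicalSpace (CoreSpace D)]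

/-- The Lagrangian `𝓛(μ, u) = sup_{f ∈ D} (⟨f, u⟩ - ⟨H f, μ⟩) ∈ [0, ∞]` for `μ ∈ 𝒫(E)`, `u ∈ D'`.
Since `f = 0` contributes the value `0`, replacing the terms by their positive parts does not
change the supremum (see `coe_lagrangian`). -/
def lagrangian [CompactSpace E] (S : FellerSemigroup E) (μ : ProbabilityMeasure E)
    (u : CoreSpace D →L[ℝ] ℝ) : ℝ≥0∞ :=
  ⨆ f : CoreSpace D, ENNReal.ofReal (u f - ∫ x, S.hamiltonian (incl f) x ∂(μ : Measure E))

theorem coe_lagrangian [CompactSpace E] (S : FellerSemigroup E) (μ : ProbabilityMeasure E)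
    (u : CoreSpace D →L[ℝ] ℝ) :
    (lagrangian S μ u : EReal) =
      ⨆ f : CoreSpace D,
        ((u f - ∫ x, S.hamiltonian (incl f) x ∂(μ : Measure E) : ℝ) : EReal) := by
  have h0 : (0 : EReal) ≤ ⨆ f : CoreSpace D,
      ((u f - ∫ x, S.hamiltonian (incl f) x ∂(μ : Measure E) : ℝ) : EReal) := by
    refine le_iSup_of_le (0 : CoreSpace D) ?_
    simp [S.hamiltonian_zero]
  refine le_antisymm ?_ (iSup_le fun f => ?_)
  · rw [← EReal.coe_toENNReal h0, EReal.coe_ennreal_le_coe_ennreal_iff]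
    refine iSup_le fun f => ?_
    rw [← EReal.coe_ennreal_le_coe_ennreal_iff, EReal.coe_toENNReal h0, EReal.coe_ennreal_ofReal]
    refine (EReal.coe_strictMono.monotone.map_max).trans_le (max_le ?_ h0)
    exact le_iSup (fun f : CoreSpace D =>
      ((u f - ∫ x, S.hamiltonian (incl f) x ∂(μ : Measure E) : ℝ) : EReal)) f
  · refine le_trans ?_ (EReal.coe_ennreal_le_coe_ennreal_iff.mpr (le_iSup (fun f : CoreSpace D =>
      ENNReal.ofReal (u f - ∫ x, S.hamiltonian (incl f) x ∂(μ : Measure E))) f))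
    rw [EReal.coe_ennreal_ofReal]
    exact EReal.coe_le_coe_iff.mpr (le_max_left _ _)

variable [BorelSpace E]

/-- `u : [0, ∞) → D'` is a velocity of the path `ν` in `𝒫(E)`: `s ↦ ⟨f, u(s)⟩` is measurable and
locally integrable for every `f ∈ D`, and `ν(t) - ν(0) = ∫₀ᵗ u(s) ds` as a Gelfand integral
in `D'`. (Only the values `u(s)` with `s ≥ 0` matter.) -/
def IsVelocity (ν : C(ℝ≥0, ProbabilityMeasure E)) (u : ℝ → CoreSpace D →L[ℝ] ℝ) : Prop :=
  (∀ f : CoreSpace D, ∀ t : ℝ≥0, IntegrableOn (fun s => u s f) (Icc 0 t)) ∧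
  ∀ t : ℝ≥0, ∀ f : CoreSpace D,
    ∫ x, incl f x ∂(ν t : Measure E) - ∫ x, incl f x ∂(ν 0 : Measure E) =
      ∫ s in (0 : ℝ)..t, u s f

/-- The velocity of an absolutely continuous path is unique up to a null set of times. -/
theorem IsVelocity.ae_eq [TopologicalSpace.SeparableSpace (CoreSpace D)]
    {ν : C(ℝ≥0, ProbabilityMeasure E)} {u v : ℝ → CoreSpace D →L[ℝ] ℝ}
    (hu : IsVelocity ν u) (hv : IsVelocity ν v) : ∀ᵐ s : ℝ, 0 < s → u s = v s := by
  have key : ∀ f : CoreSpace D, ∀ n : ℕ, ∀ᵐ s : ℝ, s ∈ Ioo (0 : ℝ) n → u s f = v s f := by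
    intro f n
    have iu : IntervalIntegrable (fun s => u s f) volume 0 n :=
      (intervalIntegrable_iff_integrableOn_Icc_of_le n.cast_nonneg).2 (hu.1 f n)
    have iv : IntervalIntegrable (fun s => v s f) volume 0 n :=
      (intervalIntegrable_iff_integrableOn_Icc_of_le n.cast_nonneg).2 (hv.1 f n)
    filter_upwards [iu.ae_hasDerivAt_integral, iv.ae_hasDerivAt_integral] with s h1 h2 hs
    have hm : s ∈ uIcc (0 : ℝ) n := by
      rw [uIcc_of_le n.cast_nonneg]; exact Ioo_subset_Icc_self hs
    have e1 := h1 hm 0 left_mem_uIcc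
    have e2 := h2 hm 0 left_mem_uIcc
    refine e1.unique (e2.congr_of_eventuallyEq ?_)
    filter_upwards [lt_mem_nhds hs.1] with t ht
    have a := hu.2 ⟨t, ht.le⟩ f
    have b := hv.2 ⟨t, ht.le⟩ f
    exact a.symm.trans b
  have key2 : ∀ᵐ s : ℝ, ∀ k n : ℕ, s ∈ Ioo (0 : ℝ) n →
      u s (TopologicalSpace.denseSeq (CoreSpace D) k) =
        v s (TopologicalSpace.denseSeq (CoreSpace D) k) :=
    ae_all_iff.2 fun k => ae_all_iff.2 fun n => key _ n
  filter_upwards [key2] with s hs h0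
  obtain ⟨n, hn⟩ := exists_nat_gt s
  refine DFunLike.coe_injective ((u s).continuous.ext_on
    (TopologicalSpace.denseRange_denseSeq _) (v s).continuous ?_)
  rintro _ ⟨k, rfl⟩
  exact hs k n ⟨h0, hn⟩

/-- The set of absolutely continuous paths `ν : [0, ∞) → 𝒫(E)`, with velocity `ν̇ = u`, such that
`∫₀ᵀ 𝓛(ν(s), ν̇(s)) ds ≤ M`. By `IsVelocity.ae_eq` the choice of `u` is immaterial when `D` is
separable. -/
def levelSet [CompactSpace E] (S : FellerSemigroup E) (D : Submodule ℝ C(E, ℝ))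
    [TopologicalSpace (CoreSpace D)] (M : ℝ) (T : ℝ≥0) :
    Set C(ℝ≥0, ProbabilityMeasure E) :=
  {ν | ∃ u : ℝ → CoreSpace D →L[ℝ] ℝ, IsVelocity ν u ∧
    ∫⁻ s in Icc (0 : ℝ) T, lagrangian S (ν s.toNNReal) (u s) ≤ ENNReal.ofReal M}

end Paths

end

end PathLD

/-! Testing the supremum in `lagrangian` with `±c f` bounds `c |⟨f, u⟩|` by the Lagrangian plus a
constant `K(c, f)`, for every `c > 0`. Hence along a path of cost at most `M` the increments of `∫ f
dν` over disjoint intervals satisfy `c * Σ |increment| ≤ M + K(c, f) * (total length)`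
(`sum_dist_integral_le`). As `c` is arbitrary, this superlinear bound yields equicontinuity and
absolute continuity, and it survives pointwise limits. Integrals over the dense set `D` determine
the topology of the compact space `𝒫(E)`, so Arzelà-Ascoli leaves only closedness to prove.

For a limit path the velocity has to be rebuilt. The increments of `∫ f dν - ∫ ∫ H f dν dr` are
dominated by the integrated cost density, uniformly in `f`; averaging over short windows and
applying Fatou twice gives a limit density `ℓ` of mass at most `M` with `(∫ f dν)' - ∫ H f dν ≤ ℓ`.
At almost every time the derivative exists for a dense subspace of `f`. Since `‖H f‖ ≤ 1` on the
barrel, it is bounded above by `ℓ + 1` on the trace of the barrel, so barrelledness and Hahn-Banach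
extend it to an element of `D'`. By continuity of `H`, the Lagrangian of this extension is still at
most `ℓ`. -/

namespace PathLD

/-! ### Extension of functionals in barrelled spaces -/

/-- In a barrelled space, a linear functional on a subspace which is bounded above on the trace of a
barrel extends to a continuous linear functional. -/
theorem exists_continuousLinearMap_extension {V : Type*} [AddCommGroup V] [Module ℝ V]
    [TopologicalSpace V] [IsTopologicalAddGroup V] [ContinuousSMul ℝ V] [BarrelledSpace ℝ V]
    {N : Set V} (hconv : Convex ℝ N) (hbal : Balanced ℝ N) (habs : Absorbent ℝ N)
    (hcl : IsClosed N) (φ : V →ₗ.[ℝ] ℝ) (C : ℝ) (hφ : ∀ x : φ.domain, (x : V) ∈ N → φ x ≤ C) :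
    ∃ g : V →L[ℝ] ℝ, ∀ x : φ.domain, g x = φ x := by
  have h0 : (0 : V) ∈ N := habs.zero_mem
  have hC : 0 ≤ C := by simpa using hφ 0 h0
  let p : Seminorm ℝ V := gaugeSeminorm hbal hconv habs
  -- Barrelledness enters here: the sublevel sets of the gauge are intersections of closed dilates
  -- of `N`, so the gauge is a lower semicontinuous seminorm, hence continuous.
  have hp : Continuous p := by
    refine p.continuous_of_lowerSemicontinuous
      (lowerSemicontinuous_iff_isClosed_preimage.2 fun a => ?_)
    change IsClosed {x | gauge N x ≤ a}
    rcases le_or_gt 0 a with ha | ha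
    · rw [setOfPred_gauge_le_eq hconv h0 habs ha]
      exact isClosed_iInter fun r => isClosed_iInter fun hr =>
        hcl.smul_of_ne_zero (ha.trans_lt hr).ne'
    · convert isClosed_empty
      exact eq_empty_iff_forall_notMem.2 fun x hx => (ha.trans_le (gauge_nonneg x)).not_ge hx
  have hle : ∀ x : φ.domain, φ x ≤ C * p x := by
    intro x
    refine le_of_forall_pos_le_add fun ε hε => ?_
    -- Rescale `x` into `N`. The denominator `C + 1` rather than `C` covers the case `C = 0`.
    obtain ⟨r, hr0, hr, y, hy, hxy⟩ := exists_lt_of_gauge_lt habs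
      (lt_add_of_pos_right (gauge N (x : V)) (show 0 < ε / (C + 1) by positivity))
    have hyx : y = r⁻¹ • (x : V) := by
      rw [← hxy]; simp [smul_smul, hr0.ne']
    have hb := hφ (r⁻¹ • x) (by simpa [← hyx] using hy)
    rw [φ.map_smul, smul_eq_mul, inv_mul_le_iff₀ hr0] at hb
    have hp' : p x = gauge N (x : V) := rfl
    rw [hp']
    have h1 : C * (ε / (C + 1)) ≤ ε := by
      rw [mul_div_assoc', div_le_iff₀ (by positivity)]; nlinarith
    nlinarith
  obtain ⟨g, hg, hgle⟩ := exists_extension_of_le_sublinear φ (fun x => C * p x)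
    (fun c hc x => by rw [map_smul_eq_mul, Real.norm_of_nonneg hc.le]; ring)
    (fun x y => by rw [← mul_add]; exact mul_le_mul_of_nonneg_left (map_add_le_add p x y) hC) hle
  have hbd : ∀ x, ‖g x‖ ≤ C * p x := fun x => by
    rw [Real.norm_eq_abs, abs_le]
    refine ⟨?_, hgle x⟩
    have := hgle (-x)
    simp only [map_neg, map_neg_eq_map] at this
    linarith
  refine ⟨⟨g, ?_⟩, hg⟩
  refine continuous_of_continuousAt_zero g ?_
  rw [ContinuousAt, map_zero]
  refine squeeze_zero_norm hbd ?_
  have : Tendsto (fun x => C * p x) (𝓝 0) (𝓝 (C * p 0)) := (continuous_const.mul hp).tendsto 0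
  simpa using this

/-! ### Limits of cost densities -/

/-- Given densities `l n` of total mass at most `M`, there is a density of total mass at most `M`
which dominates the derivative of every pointwise limit of functions whose increments are
dominated by the `l n`. -/
theorem exists_density_bounding_deriv_of_tendsto (M : ℝ≥0∞) (l : ℕ → ℝ → ℝ≥0∞)
    (hl : ∀ n, Measurable (l n)) (hM : ∀ n, ∫⁻ s, l n s ≤ M) :
    ∃ ℓ : ℝ → ℝ≥0∞, Measurable ℓ ∧ ∫⁻ s, ℓ s ≤ M ∧
      ∀ (G : ℕ → ℝ → ℝ) (G' : ℝ → ℝ) (s T g : ℝ), s < T →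
        (∀ n, ∀ t ∈ Ioc s T, ENNReal.ofReal (G n t - G n s) ≤ ∫⁻ r in Ioc s t, l n r) →
        (∀ t ∈ Icc s T, Tendsto (fun n => G n t) atTop (𝓝 (G' t))) →
        HasDerivAt G' g s → ENNReal.ofReal g ≤ ℓ s := by
  let h : ℕ → ℝ := fun k => 1 / ((k : ℝ) + 1)
  have hpos : ∀ k, 0 < h k := fun k => Nat.one_div_pos_of_nat
  -- Forward averages of `l n` over windows of length `δ`, written over a fixed window so that
  -- Tonelli and translation invariance show that averaging keeps the mass at most `M`.
  let a : ℕ → ℝ → ℝ → ℝ≥0∞ := fun n δ s => ENNReal.ofReal δ⁻¹ * ∫⁻ r in Ioc 0 δ, l n (s + r)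
  have ha_eq : ∀ n δ s, a n δ s = ENNReal.ofReal δ⁻¹ * ∫⁻ r in Ioc s (s + δ), l n r := by
    intro n δ s
    have := (measurePreserving_add_left volume s).setLIntegral_comp_preimage
      (measurableSet_Ioc (a := s) (b := s + δ)) (hl n)
    simp only [preimage_const_add_Ioc, sub_self, add_sub_cancel_left] at this
    simp only [a, this]
  have ha_meas : ∀ n δ, Measurable (a n δ) := fun n δ =>
    Measurable.const_mul (Measurable.lintegral_prod_right'
      (f := fun p : ℝ × ℝ => l n (p.1 + p.2)) ((hl n).comp measurable_add)) _
  have ha_int : ∀ n δ, 0 < δ → ∫⁻ s, a n δ s ≤ M := by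
    intro n δ hδ
    rw [lintegral_const_mul _ (Measurable.lintegral_prod_right'
      (f := fun p : ℝ × ℝ => l n (p.1 + p.2)) ((hl n).comp measurable_add)),
      lintegral_lintegral_swap (f := fun s r => l n (s + r)) ((hl n).comp measurable_add).aemeasurable]
    simp only [lintegral_add_right_eq_self (l n), lintegral_const, Measure.restrict_apply .univ,
      univ_inter, Real.volume_Ioc, sub_zero]
    rw [mul_comm, mul_assoc, ← ENNReal.ofReal_mul hδ.le, mul_inv_cancel₀ hδ.ne', ENNReal.ofReal_one,
      mul_one]
    exact hM n
  let R : ℕ → ℝ → ℝ≥0∞ := fun k s => liminf (fun n => a n (h k) s) atTop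
  have hR_meas : ∀ k, Measurable (R k) := fun k => Measurable.liminf fun n => ha_meas n _
  have hR_int : ∀ k, ∫⁻ s, R k s ≤ M := fun k =>
    (lintegral_liminf_le fun n => ha_meas n _).trans
      (liminf_le_of_frequently_le' (Frequently.of_forall fun n => ha_int n _ (hpos k)))
  -- Fatou in `n` at a fixed window, then Fatou again as the window shrinks. No weak compactness of
  -- the `l n` is needed.
  refine ⟨fun s => liminf (fun k => R k s) atTop, Measurable.liminf hR_meas,
    (lintegral_liminf_le hR_meas).trans
      (liminf_le_of_frequently_le' (Frequently.of_forall hR_int)), ?_⟩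
  intro G G' s T g hsT hG hlim hder
  have hh : Tendsto h atTop (𝓝[>] 0) :=
    tendsto_nhdsWithin_iff.2 ⟨tendsto_one_div_add_atTop_nhds_zero_nat, .of_forall hpos⟩
  have hslope : Tendsto (fun k => (h k)⁻¹ * (G' (s + h k) - G' s)) atTop (𝓝 g) :=
    (hder.tendsto_slope_zero_right.comp hh)
  have hev : ∀ᶠ k in atTop, h k < T - s :=
    (hh.mono_right nhdsWithin_le_nhds).eventually (gt_mem_nhds (sub_pos.2 hsT))
  -- At a fixed window the difference quotients of `G n` are at most the averages of `l n`, and they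
  -- converge to those of `G'`.
  have hle : ∀ᶠ k in atTop, ENNReal.ofReal ((h k)⁻¹ * (G' (s + h k) - G' s)) ≤ R k s := by
    filter_upwards [hev] with k hk
    have hk0 := hpos k
    have ht : s + h k ∈ Ioc s T := ⟨by linarith, by linarith⟩
    have h1 : Tendsto (fun n => ENNReal.ofReal ((h k)⁻¹ * (G n (s + h k) - G n s))) atTop
        (𝓝 (ENNReal.ofReal ((h k)⁻¹ * (G' (s + h k) - G' s)))) :=
      ENNReal.tendsto_ofReal (((hlim _ (Ioc_subset_Icc_self ht)).sub
        (hlim s (left_mem_Icc.2 hsT.le))).const_mul _)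
    rw [← h1.liminf_eq]
    refine liminf_le_liminf (.of_forall fun n => ?_)
    rw [ENNReal.ofReal_mul (by positivity), ha_eq]
    gcongr
    exact hG n _ ht
  rw [← (ENNReal.tendsto_ofReal hslope).liminf_eq]
  exact liminf_le_liminf hle

open CoreSpace

/-! ### Integrals of continuous functions against probability measures -/

section Pairing

variable {E : Type*} [TopologicalSpace E] [CompactSpace E] [MeasurableSpace E]

theorem abs_integral_continuousMap_le (μ : ProbabilityMeasure E) (g : C(E, ℝ)) :
    |∫ x, g x ∂(μ : Measure E)| ≤ ‖g‖ := by
  have := norm_integral_le_of_norm_le_const (μ := (μ : Measure E))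
    (Eventually.of_forall fun x => g.norm_coe_le_norm x)
  simpa using this

variable [BorelSpace E]

theorem integrable_continuousMap (μ : ProbabilityMeasure E) (g : C(E, ℝ)) :
    Integrable (fun x => g x) (μ : Measure E) :=
  (BoundedContinuousFunction.mkOfCompact g).integrable _

theorem continuous_integral_left (μ : ProbabilityMeasure E) :
    Continuous fun g : C(E, ℝ) => ∫ x, g x ∂(μ : Measure E) := by
  refine (LipschitzWith.of_dist_le_mul (K := 1) fun g h => ?_).continuous
  rw [Real.dist_eq, ← integral_sub (integrable_continuousMap μ g) (integrable_continuousMap μ h),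
    NNReal.coe_one, one_mul, dist_eq_norm]
  exact abs_integral_continuousMap_le μ (g - h)

theorem continuous_integral_right (g : C(E, ℝ)) :
    Continuous fun μ : ProbabilityMeasure E => ∫ x, g x ∂(μ : Measure E) :=
  continuous_iff_continuousAt.2 fun _ =>
    ProbabilityMeasure.tendsto_iff_forall_integral_tendsto.1 tendsto_id
      (BoundedContinuousFunction.mkOfCompact g)

/-- Integrals of functions from a dense set determine the topology of `𝒫(E)`. -/
theorem tendsto_of_forall_dense_integral_tendsto {ι : Type*} {F : Filter ι}
    {μs : ι → ProbabilityMeasure E} {μ : ProbabilityMeasure E} {D : Set C(E, ℝ)} (hD : Dense D)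
    (h : ∀ g ∈ D, Tendsto (fun i => ∫ x, g x ∂(μs i : Measure E)) F
      (𝓝 (∫ x, g x ∂(μ : Measure E)))) : Tendsto μs F (𝓝 μ) := by
  refine ProbabilityMeasure.tendsto_iff_forall_integral_tendsto.2 fun f => ?_
  rw [Metric.tendsto_nhds]
  intro ε hε
  obtain ⟨g, hgD, hg⟩ := hD.exists_dist_lt (f : C(E, ℝ)) (show 0 < ε / 3 by positivity)
  have key : ∀ κ : ProbabilityMeasure E,
      |∫ x, f x ∂(κ : Measure E) - ∫ x, g x ∂(κ : Measure E)| ≤ ε / 3 := by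
    intro κ
    rw [← integral_sub (f.integrable _) (integrable_continuousMap κ g)]
    refine (abs_integral_continuousMap_le κ ((f : C(E, ℝ)) - g)).trans ?_
    rw [← dist_eq_norm]; exact hg.le
  filter_upwards [Metric.tendsto_nhds.1 (h g hgD) (ε / 3) (by positivity)] with i hi
  rw [Real.dist_eq] at hi ⊢
  have h1 := abs_le.1 (key (μs i))
  have h2 := abs_le.1 (key μ)
  have h3 := abs_lt.1 hi
  rw [abs_lt]
  constructor <;> linarith

end Pairing

/-! ### Continuity of the Hamiltonian -/

section Hamiltonian

variable {E : Type*} [TopologicalSpace E] [CompactSpace E] {S : FellerSemigroup E}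
  {D : Submodule ℝ C(E, ℝ)}

/-- A bound for the Hamiltonian at `± c f`. -/
noncomputable def hamiltonianBound (S : FellerSemigroup E) (c : ℝ) (f : CoreSpace D) : ℝ :=
  max ‖S.hamiltonian (incl (c • f))‖ ‖S.hamiltonian (incl (-(c • f)))‖

theorem hamiltonianBound_nonneg (S : FellerSemigroup E) (c : ℝ) (f : CoreSpace D) :
    0 ≤ hamiltonianBound S c f :=
  le_max_of_le_left (norm_nonneg _)

theorem FellerSemigroup.generator_add_one (S : FellerSemigroup E) (g : C(E, ℝ)) :
    S.generator (g + 1) = S.generator g := by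
  simp only [FellerSemigroup.generator, map_add, S.op_one]
  exact derivWithin_add_const _

/-- Since `A` does not see constants, `A e^f = A (e^f - 1)`, a composition of two maps assumed
continuous. -/
theorem IsRegularCore.continuous_hamiltonian [TopologicalSpace (CoreSpace D)]
    [IsTopologicalAddGroup (CoreSpace D)]
    (hD : IsRegularCore S D) :
    Continuous fun f : CoreSpace D => S.hamiltonian (incl f) := by
  have h1 : Continuous fun f : CoreSpace D => S.generator (expC (incl f)) := by
    refine (hD.continuous_generator.comp hD.continuous_exp).congr fun f => ?_
    rw [Function.comp_apply, incl_mk, ← S.generator_add_one, sub_add_cancel]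
  have h2 : Continuous fun f : CoreSpace D => expC (incl f) := by
    refine ((hD.continuous_incl.comp hD.continuous_exp).add (continuous_const (y := 1))).congr
      fun f => ?_
    simp
  have h3 : Continuous fun f : CoreSpace D => expC (-incl f) := by
    refine (h2.comp continuous_neg).congr fun f => ?_
    rw [Function.comp_apply, map_neg]
  exact h3.mul h1

end Hamiltonian

/-! ### Superlinear growth of the Lagrangian -/

section Lagrangian

variable {E : Type*} [TopologicalSpace E] [CompactSpace E] [MeasurableSpace E]
  {S : FellerSemigroup E} {D : Submodule ℝ C(E, ℝ)} [TopologicalSpace (CoreSpace D)]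

/-- A Young-type inequality: test the supremum with `c f` or `-(c f)`, according to the sign of `u
f`. -/
theorem enorm_velocity_le (S : FellerSemigroup E) (μ : ProbabilityMeasure E)
    (u : CoreSpace D →L[ℝ] ℝ) {c : ℝ} (hc : 0 ≤ c) (f : CoreSpace D) :
    ENNReal.ofReal c * ‖u f‖ₑ ≤ lagrangian S μ u + ENNReal.ofReal (hamiltonianBound S c f) := by
  have key : ∀ g : CoreSpace D, ‖S.hamiltonian (incl g)‖ ≤ hamiltonianBound S c f →
      ENNReal.ofReal (u g) ≤ lagrangian S μ u + ENNReal.ofReal (hamiltonianBound S c f) := by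
    intro g hg
    have h1 := le_iSup (fun f : CoreSpace D =>
      ENNReal.ofReal (u f - ∫ x, S.hamiltonian (incl f) x ∂(μ : Measure E))) g
    have h2 := (abs_le.1 (abs_integral_continuousMap_le μ (S.hamiltonian (incl g)))).2
    calc ENNReal.ofReal (u g)
        ≤ ENNReal.ofReal ((u g - ∫ x, S.hamiltonian (incl g) x ∂(μ : Measure E)) +
          hamiltonianBound S c f) := ENNReal.ofReal_le_ofReal (by linarith)
      _ ≤ _ := ENNReal.ofReal_add_le.trans (by gcongr; exact h1)
  rw [Real.enorm_eq_ofReal_abs, ← ENNReal.ofReal_mul hc]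
  rcases abs_cases (u f) with ⟨h, -⟩ | ⟨h, -⟩
  · rw [h, ← smul_eq_mul, ← map_smul]
    exact key _ (le_max_left _ _)
  · rw [h, mul_neg, ← smul_eq_mul, ← map_smul, ← map_neg]
    exact key _ (le_max_right _ _)

variable [BorelSpace E]

/-- The tested expression is `τ_D`-continuous in `f`. This serves both for measurability of the
Lagrangian in time and for bounding it at a functional known only on a dense subspace. -/
theorem IsRegularCore.lagrangian_le_of_dense [IsTopologicalAddGroup (CoreSpace D)]
    (hD : IsRegularCore S D) (μ : ProbabilityMeasure E)
    (u : CoreSpace D →L[ℝ] ℝ) {W : Set (CoreSpace D)} (hW : Dense W) {c : ℝ≥0∞}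
    (h : ∀ f ∈ W, ENNReal.ofReal (u f - ∫ x, S.hamiltonian (incl f) x ∂(μ : Measure E)) ≤ c) :
    lagrangian S μ u ≤ c := by
  have hc : IsClosed {f : CoreSpace D |
      ENNReal.ofReal (u f - ∫ x, S.hamiltonian (incl f) x ∂(μ : Measure E)) ≤ c} :=
    isClosed_le (ENNReal.continuous_ofReal.comp
      (u.continuous.sub ((continuous_integral_left μ).comp hD.continuous_hamiltonian)))
      continuous_const
  exact iSup_le fun f => hc.closure_subset_iff.2 h (hW f)

theorem IsRegularCore.lagrangian_eq_iSup_denseSeq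
    [IsTopologicalAddGroup (CoreSpace D)] [TopologicalSpace.SeparableSpace (CoreSpace D)] (hD : IsRegularCore S D)
    (μ : ProbabilityMeasure E) (u : CoreSpace D →L[ℝ] ℝ) :
    lagrangian S μ u = ⨆ k, ENNReal.ofReal (u (TopologicalSpace.denseSeq (CoreSpace D) k) -
      ∫ x, S.hamiltonian (incl (TopologicalSpace.denseSeq (CoreSpace D) k)) x
        ∂(μ : Measure E)) := by
  refine le_antisymm (hD.lagrangian_le_of_dense μ u (TopologicalSpace.denseRange_denseSeq _) ?_)
    (iSup_le fun k => le_iSup (fun f : CoreSpace D =>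
      ENNReal.ofReal (u f - ∫ x, S.hamiltonian (incl f) x ∂(μ : Measure E))) _)
  rintro _ ⟨k, rfl⟩
  exact le_iSup (fun k => ENNReal.ofReal (u (TopologicalSpace.denseSeq (CoreSpace D) k) -
      ∫ x, S.hamiltonian (incl (TopologicalSpace.denseSeq (CoreSpace D) k)) x ∂(μ : Measure E))) k

theorem continuous_integral_path (ν : C(ℝ≥0, ProbabilityMeasure E)) (g : C(E, ℝ)) :
    Continuous fun s : ℝ => ∫ x, g x ∂(ν s.toNNReal : Measure E) :=
  (continuous_integral_right g).comp (ν.continuous.comp continuous_real_toNNReal)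

theorem IsRegularCore.aemeasurable_lagrangian
    [IsTopologicalAddGroup (CoreSpace D)] [TopologicalSpace.SeparableSpace (CoreSpace D)] (hD : IsRegularCore S D)
    {ν : C(ℝ≥0, ProbabilityMeasure E)} {u : ℝ → CoreSpace D →L[ℝ] ℝ} (hu : IsVelocity ν u)
    (T : ℝ≥0) :
    AEMeasurable (fun s => lagrangian S (ν s.toNNReal) (u s))
      (volume.restrict (Icc (0 : ℝ) T)) := by
  simp only [hD.lagrangian_eq_iSup_denseSeq]
  exact AEMeasurable.iSup fun k => ((hu.1 _ T).aemeasurable.sub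
    (continuous_integral_path ν _).measurable.aemeasurable).ennreal_ofReal

theorem setLIntegral_enorm_velocity_le {ν : C(ℝ≥0, ProbabilityMeasure E)}
    {u : ℝ → CoreSpace D →L[ℝ] ℝ} {M : ℝ} {T : ℝ≥0}
    (hM : ∫⁻ s in Icc (0 : ℝ) T, lagrangian S (ν s.toNNReal) (u s) ≤ ENNReal.ofReal M)
    {c : ℝ} (hc : 0 ≤ c) (f : CoreSpace D) {A : Set ℝ} (hA : A ⊆ Icc (0 : ℝ) T) :
    ENNReal.ofReal c * ∫⁻ s in A, ‖u s f‖ₑ ≤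
      ENNReal.ofReal M + ENNReal.ofReal (hamiltonianBound S c f) * volume A := by
  calc ENNReal.ofReal c * ∫⁻ s in A, ‖u s f‖ₑ
      ≤ ∫⁻ s in A, ENNReal.ofReal c * ‖u s f‖ₑ := lintegral_const_mul_le _ _
    _ ≤ ∫⁻ s in A, (lagrangian S (ν s.toNNReal) (u s) +
          ENNReal.ofReal (hamiltonianBound S c f)) :=
        lintegral_mono fun s => enorm_velocity_le S _ _ hc f
    _ = (∫⁻ s in A, lagrangian S (ν s.toNNReal) (u s)) +
          ENNReal.ofReal (hamiltonianBound S c f) * volume A := by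
        rw [lintegral_add_right _ measurable_const, setLIntegral_const]
    _ ≤ _ := by
        gcongr
        exact (lintegral_mono_set hA).trans hM

/-- The increments over disjoint intervals of the integrals of `f` along a path of cost at
most `M`. -/
theorem sum_dist_integral_le {ν : C(ℝ≥0, ProbabilityMeasure E)} {M : ℝ} (hM0 : 0 ≤ M) {T : ℝ≥0}
    (hν : ν ∈ levelSet S D M T) {c : ℝ} (hc : 0 < c) (f : CoreSpace D)
    {I : ℕ × (ℕ → ℝ × ℝ)} (hI : I ∈ AbsolutelyContinuousOnInterval.disjWithin 0 (T : ℝ)) :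
    c * ∑ i ∈ Finset.range I.1, dist (∫ x, incl f x ∂(ν (I.2 i).1.toNNReal : Measure E))
        (∫ x, incl f x ∂(ν (I.2 i).2.toNNReal : Measure E)) ≤
      M + hamiltonianBound S c f * ∑ i ∈ Finset.range I.1, dist (I.2 i).1 (I.2 i).2 := by
  obtain ⟨u, hu, hcost⟩ := hν
  have hsub : (⋃ i ∈ Finset.range I.1, uIoc (I.2 i).1 (I.2 i).2) ⊆ Icc 0 (T : ℝ) := by
    refine (AbsolutelyContinuousOnInterval.biUnion_uIoc_subset_of_mem_disjWithin hI).trans ?_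
    rw [uIoc_of_le T.coe_nonneg]; exact Ioc_subset_Icc_self
  have hint : ∀ a b : ℝ, a ∈ Icc 0 (T : ℝ) → b ∈ Icc 0 (T : ℝ) →
      IntervalIntegrable (fun s => u s f) volume a b := fun a b ha hb =>
    ((hu.1 f T).mono_set (ordConnected_Icc.uIcc_subset ha hb)).intervalIntegrable
  have hinc : ∀ i ∈ Finset.range I.1,
      edist (∫ x, incl f x ∂(ν (I.2 i).1.toNNReal : Measure E))
        (∫ x, incl f x ∂(ν (I.2 i).2.toNNReal : Measure E)) ≤
      ∫⁻ s in uIoc (I.2 i).1 (I.2 i).2, ‖u s f‖ₑ := by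
    intro i hi
    obtain ⟨ha, hb⟩ := hI.1 i hi
    rw [uIcc_of_le T.coe_nonneg] at ha hb
    have h0 : (0 : ℝ) ∈ Icc 0 (T : ℝ) := ⟨le_rfl, T.2⟩
    have e1 := hu.2 (I.2 i).1.toNNReal f
    have e2 := hu.2 (I.2 i).2.toNNReal f
    rw [Real.coe_toNNReal _ ha.1] at e1
    rw [Real.coe_toNNReal _ hb.1] at e2
    have e3 := intervalIntegral.integral_interval_sub_left (hint 0 _ h0 hb) (hint 0 _ h0 ha)
    rw [edist_comm, edist_eq_enorm_sub, show ∀ a b d : ℝ, a - b = (a - d) - (b - d) by intros; ring,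
      e2, e1, e3]
    rw [← enorm_norm, intervalIntegral.norm_integral_eq_norm_integral_uIoc, enorm_norm]
    exact enorm_integral_le_lintegral_enorm _
  have hsum : ∑ i ∈ Finset.range I.1, ∫⁻ s in uIoc (I.2 i).1 (I.2 i).2, ‖u s f‖ₑ =
      ∫⁻ s in ⋃ i ∈ Finset.range I.1, uIoc (I.2 i).1 (I.2 i).2, ‖u s f‖ₑ :=
    (lintegral_biUnion_finset hI.2 (fun _ _ => measurableSet_uIoc) _).symm
  have hvol : volume (⋃ i ∈ Finset.range I.1, uIoc (I.2 i).1 (I.2 i).2) =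
      ENNReal.ofReal (∑ i ∈ Finset.range I.1, dist (I.2 i).1 (I.2 i).2) := by
    rw [measure_biUnion_finset hI.2 fun _ _ => measurableSet_uIoc,
      ENNReal.ofReal_sum_of_nonneg fun _ _ => dist_nonneg]
    refine Finset.sum_congr rfl fun i _ => ?_
    rw [Real.volume_uIoc, dist_comm, Real.dist_eq]
  -- Applied to the union of the disjoint intervals, so that `M` is paid once and not once per
  -- interval.
  have main := setLIntegral_enorm_velocity_le hcost hc.le f hsub
  have hB := hamiltonianBound_nonneg S c f
  have hd : 0 ≤ ∑ i ∈ Finset.range I.1, dist (I.2 i).1 (I.2 i).2 :=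
    Finset.sum_nonneg fun _ _ => dist_nonneg
  rw [hvol, ← ENNReal.ofReal_mul hB, ← ENNReal.ofReal_add hM0 (mul_nonneg hB hd), ← hsum] at main
  rw [← ENNReal.ofReal_le_ofReal_iff (add_nonneg hM0 (mul_nonneg hB hd)),
    ENNReal.ofReal_mul hc.le, ENNReal.ofReal_sum_of_nonneg fun _ _ => dist_nonneg]
  refine le_trans ?_ main
  gcongr with i hi
  rw [← edist_dist]
  exact hinc i hi

end Lagrangian

/-- After division by `c` the term `M / c` is made small by a large `c`; with `c` and hence `K`
fixed, a short total length controls the other term. -/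
theorem absolutelyContinuousOnInterval_of_sum_dist_le {F : ℝ → ℝ} {a b M : ℝ} (hM : 0 ≤ M)
    (h : ∀ c : ℝ, 0 < c → ∃ K : ℝ, 0 ≤ K ∧
      ∀ I ∈ AbsolutelyContinuousOnInterval.disjWithin a b,
        c * ∑ i ∈ Finset.range I.1, dist (F (I.2 i).1) (F (I.2 i).2) ≤
          M + K * ∑ i ∈ Finset.range I.1, dist (I.2 i).1 (I.2 i).2) :
    AbsolutelyContinuousOnInterval F a b := by
  rw [absolutelyContinuousOnInterval_iff]
  intro ε hε
  obtain ⟨K, hK, hI⟩ := h ((M + 1) / (ε / 2)) (by positivity)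
  refine ⟨1 / (K + 1), by positivity, fun I hIm hIlt => ?_⟩
  have h1 := hI I hIm
  rw [lt_div_iff₀ (by positivity)] at hIlt
  have hd : 0 ≤ ∑ i ∈ Finset.range I.1, dist (I.2 i).1 (I.2 i).2 :=
    Finset.sum_nonneg fun _ _ => dist_nonneg
  have h2 : (M + 1) / (ε / 2) * ∑ i ∈ Finset.range I.1, dist (F (I.2 i).1) (F (I.2 i).2) ≤
      M + 1 := by nlinarith
  rw [div_mul_eq_mul_div, div_le_iff₀ (by positivity)] at h2
  have := le_of_mul_le_mul_left h2 (by positivity)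
  linarith

/-! ### Closedness of the level sets -/

section Limit

variable {E : Type*} [TopologicalSpace E] [CompactSpace E] [MeasurableSpace E] [BorelSpace E]
  {S : FellerSemigroup E} {D : Submodule ℝ C(E, ℝ)} [TopologicalSpace (CoreSpace D)]
  [IsTopologicalAddGroup (CoreSpace D)]

/-- The cost density of a path in a level set dominates the increments of the integrals of `f`
along the path, corrected by the accumulated Hamiltonian. -/
theorem IsRegularCore.exists_density_of_mem_levelSet
    [TopologicalSpace.SeparableSpace (CoreSpace D)] (hD : IsRegularCore S D)
    {ν : C(ℝ≥0, ProbabilityMeasure E)} {M : ℝ} {T : ℝ≥0} (hν : ν ∈ levelSet S D M T) :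
    ∃ l : ℝ → ℝ≥0∞, Measurable l ∧ ∫⁻ s, l s ≤ ENNReal.ofReal M ∧
      ∀ (f : CoreSpace D) (s t : ℝ), 0 ≤ s → s ≤ t → t ≤ T →
        ENNReal.ofReal
          ((∫ x, incl f x ∂(ν t.toNNReal : Measure E) -
              ∫ r in (0 : ℝ)..t, ∫ x, S.hamiltonian (incl f) x ∂(ν r.toNNReal : Measure E)) -
            (∫ x, incl f x ∂(ν s.toNNReal : Measure E) -
              ∫ r in (0 : ℝ)..s, ∫ x, S.hamiltonian (incl f) x ∂(ν r.toNNReal : Measure E))) ≤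
          ∫⁻ r in Ioc s t, l r := by
  obtain ⟨u, hu, hcost⟩ := hν
  have hm := hD.aemeasurable_lagrangian hu T
  refine ⟨(Icc (0 : ℝ) T).indicator (hm.mk _), hm.measurable_mk.indicator measurableSet_Icc, ?_, ?_⟩
  · rw [lintegral_indicator measurableSet_Icc, ← lintegral_congr_ae hm.ae_eq_mk]
    exact hcost
  intro f s t hs hst htT
  have hsub : Ioc s t ⊆ Icc (0 : ℝ) T := fun r hr => ⟨hs.trans hr.1.le, hr.2.trans htT⟩
  have hHint : ∀ a b : ℝ, IntervalIntegrable
      (fun r => ∫ x, S.hamiltonian (incl f) x ∂(ν r.toNNReal : Measure E)) volume a b :=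
    fun a b => (continuous_integral_path ν _).intervalIntegrable a b
  have hint : ∀ a b : ℝ, a ∈ Icc 0 (T : ℝ) → b ∈ Icc 0 (T : ℝ) →
      IntervalIntegrable (fun s => u s f) volume a b := fun a b ha hb =>
    ((hu.1 f T).mono_set (ordConnected_Icc.uIcc_subset ha hb)).intervalIntegrable
  have h0 : (0 : ℝ) ∈ Icc 0 (T : ℝ) := ⟨le_rfl, T.coe_nonneg⟩
  have hs' : s ∈ Icc 0 (T : ℝ) := ⟨hs, hst.trans htT⟩
  have ht' : t ∈ Icc 0 (T : ℝ) := ⟨hs.trans hst, htT⟩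
  have e1 := hu.2 s.toNNReal f
  have e2 := hu.2 t.toNNReal f
  rw [Real.coe_toNNReal _ hs] at e1
  rw [Real.coe_toNNReal _ ht'.1] at e2
  have e3 := intervalIntegral.integral_interval_sub_left (hint 0 _ h0 ht') (hint 0 _ h0 hs')
  have e4 := intervalIntegral.integral_interval_sub_left (hHint 0 t) (hHint 0 s)
  have e5 := intervalIntegral.integral_sub (hint s t hs' ht') (hHint s t)
  -- The corrected increment is the integral of exactly the expression whose supremum over `f` is
  -- the Lagrangian.
  have heq : (∫ x, incl f x ∂(ν t.toNNReal : Measure E) -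
              ∫ r in (0 : ℝ)..t, ∫ x, S.hamiltonian (incl f) x ∂(ν r.toNNReal : Measure E)) -
            (∫ x, incl f x ∂(ν s.toNNReal : Measure E) -
              ∫ r in (0 : ℝ)..s, ∫ x, S.hamiltonian (incl f) x ∂(ν r.toNNReal : Measure E)) =
      ∫ r in Ioc s t, (u r f - ∫ x, S.hamiltonian (incl f) x ∂(ν r.toNNReal : Measure E)) := by
    rw [← intervalIntegral.integral_of_le hst, e5]
    linarith
  rw [heq]
  calc ENNReal.ofReal
        (∫ r in Ioc s t, (u r f - ∫ x, S.hamiltonian (incl f) x ∂(ν r.toNNReal : Measure E)))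
      ≤ ∫⁻ r in Ioc s t, ENNReal.ofReal
          (u r f - ∫ x, S.hamiltonian (incl f) x ∂(ν r.toNNReal : Measure E)) := by
        have hI := ((hint s t hs' ht').sub (hHint s t)).1
        refine (ENNReal.ofReal_le_ofReal (integral_mono hI hI.pos_part
          fun r => le_max_left _ _)).trans ?_
        rw [ofReal_integral_eq_lintegral_ofReal hI.pos_part
          (Eventually.of_forall fun r => le_max_right _ _)]
        refine lintegral_mono fun r => ?_
        rw [ENNReal.ofReal_max]
        simp
    _ ≤ ∫⁻ r in Ioc s t, lagrangian S (ν r.toNNReal) (u r) :=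
        lintegral_mono fun r => le_iSup (fun f : CoreSpace D => ENNReal.ofReal
          (u r f - ∫ x, S.hamiltonian (incl f) x ∂(ν r.toNNReal : Measure E))) f
    _ = ∫⁻ r in Ioc s t, hm.mk _ r :=
        lintegral_congr_ae (ae_restrict_of_ae_restrict_of_subset hsub hm.ae_eq_mk)
    _ = ∫⁻ r in Ioc s t, (Icc (0 : ℝ) T).indicator (hm.mk _) r :=
        setLIntegral_congr_fun measurableSet_Ioc fun r hr => by
          rw [indicator_of_mem (hsub hr)]

/-- A path is in a level set when its integrals are absolutely continuous in time and their
derivatives are controlled by a density of mass at most `M`. -/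
theorem IsRegularCore.mem_levelSet_of_density [ContinuousSMul ℝ (CoreSpace D)]
    [TopologicalSpace.SeparableSpace (CoreSpace D)] [BarrelledSpace ℝ (CoreSpace D)]
    (hD : IsRegularCore S D) {ν : C(ℝ≥0, ProbabilityMeasure E)} {M : ℝ} {T : ℝ≥0}
    (hconst : ∀ t, T ≤ t → ν t = ν T)
    (hac : ∀ f : CoreSpace D, AbsolutelyContinuousOnInterval
      (fun t : ℝ => ∫ x, incl f x ∂(ν t.toNNReal : Measure E)) 0 T)
    {l : ℝ → ℝ≥0∞} (hl : Measurable l) (hlM : ∫⁻ s, l s ≤ ENNReal.ofReal M)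
    (hder : ∀ (f : CoreSpace D) (s g : ℝ), s ∈ Ioo (0 : ℝ) T →
      HasDerivAt (fun t : ℝ => ∫ x, incl f x ∂(ν t.toNNReal : Measure E)) g s →
        ENNReal.ofReal (g - ∫ x, S.hamiltonian (incl f) x ∂(ν s.toNNReal : Measure E)) ≤ l s) :
    ν ∈ levelSet S D M T := by
  classical
  set F : CoreSpace D → ℝ → ℝ := fun f t => ∫ x, incl f x ∂(ν t.toNNReal : Measure E) with hF
  have hadd : ∀ f g, F (f + g) = fun t => F f t + F g t := fun f g => by
    funext t
    simp only [hF, map_add, ContinuousMap.add_apply]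
    exact integral_add (integrable_continuousMap _ _) (integrable_continuousMap _ _)
  have hsmul : ∀ (c : ℝ) f, F (c • f) = fun t => c * F f t := fun c f => by
    funext t
    simp only [hF, map_smul, ContinuousMap.smul_apply, smul_eq_mul]
    exact integral_const_mul _ _
  -- The null set of non-differentiability depends on `f`, so the derivative at time `s` is defined
  -- only on the subspace `W s`.
  let W : ℝ → Submodule ℝ (CoreSpace D) := fun s =>
    { carrier := {f | DifferentiableAt ℝ (F f) s}
      add_mem' := fun {f g} hf hg => by
        change DifferentiableAt ℝ (F (f + g)) s
        rw [hadd]; exact DifferentiableAt.fun_add hf hg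
      zero_mem' := by
        change DifferentiableAt ℝ (F 0) s
        simp [hF]
      smul_mem' := fun c f hf => by
        change DifferentiableAt ℝ (F (c • f)) s
        rw [hsmul]; exact DifferentiableAt.const_mul hf c }
  let φ : ℝ → (CoreSpace D →ₗ.[ℝ] ℝ) := fun s => ⟨W s,
    { toFun := fun f => deriv (F f) s
      map_add' := fun f g => by
        rw [Submodule.coe_add, hadd]
        exact deriv_fun_add f.2 g.2
      map_smul' := fun c f => by
        rw [Submodule.coe_smul, hsmul]
        exact deriv_const_mul c f.2 }⟩
  let good : Set ℝ := {s | s ∈ Ioo (0 : ℝ) T ∧ l s ≠ ⊤ ∧ Dense (W s : Set (CoreSpace D))}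
  have hext : ∀ s ∈ good, ∃ g : CoreSpace D →L[ℝ] ℝ, (∀ f ∈ W s, g f = deriv (F f) s) ∧
      lagrangian S (ν s.toNNReal) g ≤ l s := by
    rintro s ⟨hs, hls, hW⟩
    have hle : ∀ f ∈ W s, ENNReal.ofReal
        (deriv (F f) s - ∫ x, S.hamiltonian (incl f) x ∂(ν s.toNNReal : Measure E)) ≤ l s :=
      fun f hf => hder f s _ hs (DifferentiableAt.hasDerivAt hf)
    obtain ⟨N, hconv, hbal, habs, hcl, hN, -⟩ := hD.exists_barrel
    obtain ⟨g, hg⟩ := exists_continuousLinearMap_extension hconv hbal habs hcl (φ s)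
      ((l s).toReal + 1) fun f hf => by
        have h1 := (ENNReal.ofReal_le_iff_le_toReal hls).1 (hle f f.2)
        have h2 := (abs_le.1 ((abs_integral_continuousMap_le (ν s.toNNReal)
          (S.hamiltonian (incl (f : CoreSpace D)))).trans (hN f hf))).2
        change deriv (F f) s ≤ _
        linarith
    have hg' : ∀ f ∈ W s, g f = deriv (F f) s := fun f hf => hg ⟨f, hf⟩
    refine ⟨g, hg', hD.lagrangian_le_of_dense _ g hW fun f hf => ?_⟩
    rw [hg' f hf]
    exact hle f hf
  choose! v hv hvl using hext
  have hdiff : ∀ f, ∀ᵐ s : ℝ, s ∈ Ioo (0 : ℝ) T → f ∈ W s := fun f => by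
    filter_upwards [(hac f).ae_differentiableAt] with s hs hsT
    exact hs (by rw [uIcc_of_le T.coe_nonneg]; exact Ioo_subset_Icc_self hsT)
  have hgood : ∀ᵐ s : ℝ, s ∈ Ioo (0 : ℝ) T → s ∈ good := by
    have h1 : ∀ᵐ s : ℝ, l s < ⊤ := ae_lt_top hl (hlM.trans_lt ENNReal.ofReal_lt_top).ne
    -- Countably many `f` suffice for density of `W s`, so the exceptional times form a null set.
    have h2 : ∀ᵐ s : ℝ, ∀ k, s ∈ Ioo (0 : ℝ) T →
        TopologicalSpace.denseSeq (CoreSpace D) k ∈ W s := ae_all_iff.2 fun k => hdiff _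
    filter_upwards [h1, h2] with s hs1 hs2 hs
    refine ⟨hs, hs1.ne, (TopologicalSpace.denseRange_denseSeq (CoreSpace D)).mono ?_⟩
    rintro _ ⟨k, rfl⟩
    exact hs2 k hs
  let u : ℝ → CoreSpace D →L[ℝ] ℝ := fun s => if s ∈ good then v s else 0
  -- For a fixed `f`, almost every `s` has `f ∈ W s`, where the extension agrees with the
  -- derivative. Outside `(0, T)` the velocity is zero, matching a path that rests after `T`.
  have hu : ∀ f, (fun s => u s f) =ᵐ[volume] (Ioo (0 : ℝ) T).indicator (deriv (F f)) := fun f => by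
    filter_upwards [hgood, hdiff f] with s hs1 hs2
    by_cases hs : s ∈ Ioo (0 : ℝ) T
    · simp only [u, if_pos (hs1 hs), indicator_of_mem hs]
      exact hv s (hs1 hs) f (hs2 hs)
    · simp only [u, if_neg fun h : s ∈ good => hs h.1, indicator_of_notMem hs]
      rfl
  have hFint : ∀ f, IntegrableOn (deriv (F f)) (Ioo (0 : ℝ) T) := fun f =>
    ((intervalIntegrable_iff_integrableOn_Ioo_of_le T.coe_nonneg).1 (hac f).intervalIntegrable_deriv)
  have huint : ∀ f, Integrable fun s => u s f := fun f =>
    ((integrable_indicator_iff measurableSet_Ioo).2 (hFint f)).congr (hu f).symm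
  refine ⟨u, ⟨fun f t => (huint f).integrableOn, fun t f => ?_⟩, ?_⟩
  · have hmin : ∀ f, ∫ s in (0 : ℝ)..t, u s f = ∫ s in (0 : ℝ)..(min t T : ℝ≥0), deriv (F f) s := by
      intro f
      rw [intervalIntegral.integral_of_le t.coe_nonneg, intervalIntegral.integral_of_le
        (NNReal.coe_nonneg _), integral_congr_ae (ae_restrict_of_ae (hu f)),
        integral_Ioc_eq_integral_Ioo, integral_Ioc_eq_integral_Ioo,
        setIntegral_indicator measurableSet_Ioo, Ioo_inter_Ioo]
      simp
    have hsub : AbsolutelyContinuousOnInterval (F f) 0 (min t T : ℝ≥0) := by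
      refine (hac f).mono (uIcc_subset_uIcc_left ?_)
      rw [uIcc_of_le T.coe_nonneg]
      exact ⟨NNReal.coe_nonneg _, NNReal.coe_le_coe.2 (min_le_right _ _)⟩
    rw [hmin, hsub.integral_deriv_eq_sub]
    simp only [hF, Real.toNNReal_coe, Real.toNNReal_zero]
    rcases le_total t T with h | h
    · rw [min_eq_left h]
    · rw [min_eq_right h, hconst t h]
  · refine le_trans ?_ hlM
    rw [setLIntegral_congr Ioo_ae_eq_Icc.symm]
    refine le_trans ?_ (setLIntegral_le_lintegral (Ioo (0 : ℝ) T) _)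
    refine setLIntegral_mono_ae hl.aemeasurable ?_
    filter_upwards [hgood] with s hs1 hs
    simp only [u, if_pos (hs1 hs)]
    exact hvl s (hs1 hs)

/-- Level sets are closed under pointwise convergence on `[0, T]` to paths which rest
after time `T`. -/
theorem IsRegularCore.mem_levelSet_of_tendsto [ContinuousSMul ℝ (CoreSpace D)]
    [TopologicalSpace.SeparableSpace (CoreSpace D)] [BarrelledSpace ℝ (CoreSpace D)]
    (hD : IsRegularCore S D) {νs : ℕ → C(ℝ≥0, ProbabilityMeasure E)}
    {ν : C(ℝ≥0, ProbabilityMeasure E)} {M : ℝ} (hM : 0 ≤ M) {T : ℝ≥0}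
    (hνs : ∀ n, νs n ∈ levelSet S D M T)
    (hlim : ∀ t ≤ T, Tendsto (fun n => νs n t) atTop (𝓝 (ν t)))
    (hconst : ∀ t, T ≤ t → ν t = ν T) : ν ∈ levelSet S D M T := by
  have hlim' : ∀ (g : C(E, ℝ)) (t : ℝ), t ≤ T →
      Tendsto (fun n => ∫ x, g x ∂(νs n t.toNNReal : Measure E)) atTop
        (𝓝 (∫ x, g x ∂(ν t.toNNReal : Measure E))) := fun g t ht =>
    ((continuous_integral_right g).tendsto _).comp (hlim _ (Real.toNNReal_le_iff_le_coe.2 ht))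
  choose l hl hlM hinc using fun n => hD.exists_density_of_mem_levelSet (hνs n)
  obtain ⟨ℓ, hℓ, hℓM, hbound⟩ := exists_density_bounding_deriv_of_tendsto _ l hl hlM
  refine hD.mem_levelSet_of_density hconst (fun f => ?_) hℓ hℓM fun f s g hs hg => ?_
  · refine absolutelyContinuousOnInterval_of_sum_dist_le hM fun c hc =>
      ⟨hamiltonianBound S c f, hamiltonianBound_nonneg S c f, fun I hI => ?_⟩
    -- The bound involves finitely many times only, so it passes to pointwise limits.
    have hterm : Tendsto (fun n => c * ∑ i ∈ Finset.range I.1,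
        dist (∫ x, incl f x ∂(νs n (I.2 i).1.toNNReal : Measure E))
          (∫ x, incl f x ∂(νs n (I.2 i).2.toNNReal : Measure E))) atTop
        (𝓝 (c * ∑ i ∈ Finset.range I.1,
          dist (∫ x, incl f x ∂(ν (I.2 i).1.toNNReal : Measure E))
            (∫ x, incl f x ∂(ν (I.2 i).2.toNNReal : Measure E)))) := by
      refine Tendsto.const_mul c (tendsto_finsetSum _ fun i hi => ?_)
      obtain ⟨ha, hb⟩ := hI.1 i hi
      rw [uIcc_of_le T.coe_nonneg] at ha hb
      exact (hlim' _ _ ha.2).dist (hlim' _ _ hb.2)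
    exact le_of_tendsto' hterm fun n => sum_dist_integral_le hM (hνs n) hc f hI
  -- The corrected integrals converge by dominated convergence, and the limit has derivative `g - ∫
  -- H f dν` at `s` by the fundamental theorem of calculus.
  · refine hbound (fun n t => ∫ x, incl f x ∂(νs n t.toNNReal : Measure E) -
        ∫ r in (0 : ℝ)..t, ∫ x, S.hamiltonian (incl f) x ∂(νs n r.toNNReal : Measure E))
      (fun t => ∫ x, incl f x ∂(ν t.toNNReal : Measure E) -
        ∫ r in (0 : ℝ)..t, ∫ x, S.hamiltonian (incl f) x ∂(ν r.toNNReal : Measure E))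
      s T _ hs.2 (fun n t ht => hinc n f s t hs.1.le ht.1.le ht.2) (fun t ht => ?_) ?_
    · refine (hlim' _ t ht.2).sub ?_
      refine intervalIntegral.tendsto_integral_filter_of_dominated_convergence
        (fun _ => ‖S.hamiltonian (incl f)‖)
        (.of_forall fun n => (continuous_integral_path (νs n) _).aestronglyMeasurable)
        (.of_forall fun n => .of_forall fun r _ => abs_integral_continuousMap_le _ _)
        intervalIntegrable_const (.of_forall fun r hr => hlim' _ r ?_)
      rw [uIoc_of_le (hs.1.le.trans ht.1)] at hr
      exact hr.2.trans ht.2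
    · exact hg.sub ((continuous_integral_path ν _).integral_hasStrictDerivAt 0 s).hasDerivAt

end Limit

/-! ### Arzelà-Ascoli for paths of measures -/

section Compactness

variable {E : Type*} [TopologicalSpace E] [CompactSpace E] [MeasurableSpace E] [BorelSpace E]

/-- Provides a uniformity on `𝒫(E)`, generated by the integrals of `f ∈ D`, for which equicontinuity
can be checked one `f` at a time. -/
theorem probabilityMeasure_topology_eq_iInf_induced {D : Submodule ℝ C(E, ℝ)}
    (hD : Dense (D : Set C(E, ℝ))) :
    (inferInstance : TopologicalSpace (ProbabilityMeasure E)) =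
      ⨅ f : CoreSpace D, TopologicalSpace.induced
        (fun μ : ProbabilityMeasure E => ∫ x, incl f x ∂(μ : Measure E)) inferInstance := by
  refine le_antisymm
    (le_iInf fun f => continuous_iff_le_induced.1 (continuous_integral_right _))
    (le_of_nhds_le_nhds fun μ => ?_)
  rw [nhds_iInf]
  refine (iInf_mono fun f => (nhds_induced _ _).le).trans ?_
  change Tendsto id _ _
  refine tendsto_of_forall_dense_integral_tendsto (μs := id) (μ := μ) hD fun g hg => ?_
  exact tendsto_iInf' (f := fun μ' : ProbabilityMeasure E => ∫ x, g x ∂(μ' : Measure E))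
    (CoreSpace.mk g hg) tendsto_comap

/-- A version of the Arzelà-Ascoli theorem for paths of probability measures: a superlinear bound on
the modulus of continuity of the integrals of a dense set of functions defines a compact set. -/
theorem isCompact_setOf_dist_integral_le [T2Space E]
    {D : Submodule ℝ C(E, ℝ)}
    (hD : Dense (D : Set C(E, ℝ))) {X : Type*} [PseudoMetricSpace X] (M : ℝ)
    (K : ℝ → CoreSpace D → ℝ) :
    IsCompact {η : C(X, ProbabilityMeasure E) | ∀ (c : ℝ) (f : CoreSpace D), 0 < c → ∀ s t,
      c * dist (∫ x, incl f x ∂(η s : Measure E)) (∫ x, incl f x ∂(η t : Measure E)) ≤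
        M + K c f * dist s t} := by
  let P : (X → ProbabilityMeasure E) → Prop := fun η =>
    ∀ (c : ℝ) (f : CoreSpace D), 0 < c → ∀ s t,
      c * dist (∫ x, incl f x ∂(η s : Measure E)) (∫ x, incl f x ∂(η t : Measure E)) ≤
        M + K c f * dist s t
  have hP : ∀ (f : CoreSpace D) (s : X) (ε : ℝ), 0 < ε → ∀ᶠ t in 𝓝 s, ∀ η, P η →
      dist (∫ x, incl f x ∂(η s : Measure E)) (∫ x, incl f x ∂(η t : Measure E)) < ε := by
    intro f s ε hε
    -- With this `c`, once `t` is close enough to `s` that the right side is below `|M| + 1`, the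
    -- distance is below `ε`.
    have hc : 0 < (|M| + 1) / ε := by positivity
    have h1 : Tendsto (fun t => M + K ((|M| + 1) / ε) f * dist s t) (𝓝 s)
        (𝓝 (M + K ((|M| + 1) / ε) f * dist s s)) :=
      (continuous_const.add (continuous_const.mul (continuous_const.dist continuous_id))).tendsto s
    rw [dist_self, mul_zero, add_zero] at h1
    filter_upwards [h1.eventually (gt_mem_nhds
      ((le_abs_self M).trans_lt (lt_add_one |M|)))] with t ht η hη
    have h2 := (hη _ f hc s t).trans_lt ht
    rw [div_mul_eq_mul_div, div_lt_iff₀ hε] at h2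
    exact lt_of_mul_lt_mul_left h2 (by positivity)
  let U : CoreSpace D → UniformSpace (ProbabilityMeasure E) := fun f =>
    UniformSpace.comap (fun μ => ∫ x, incl f x ∂(μ : Measure E)) inferInstance
  have hU : (inferInstance : TopologicalSpace (ProbabilityMeasure E)) =
      (⨅ f, U f).toTopologicalSpace := by
    rw [UniformSpace.toTopologicalSpace_iInf]
    exact probabilityMeasure_topology_eq_iInf_induced hD
  let UE : UniformSpace (ProbabilityMeasure E) := (⨅ f, U f).replaceTopology hU
  have hUE : UE = ⨅ f, U f := UniformSpace.replaceTopology_eq _ hU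
  have hequi : ∀ {ι : Type _} (F : ι → X → ProbabilityMeasure E), (∀ i, P (F i)) →
      Equicontinuous F := by
    intro ι F hF
    rw [hUE, equicontinuous_iInf_rng]
    intro f
    have hind := @IsUniformInducing.mk _ _ (U f) _
      (fun μ : ProbabilityMeasure E => ∫ x, incl f x ∂(μ : Measure E)) rfl
    rw [@IsUniformInducing.equicontinuous_iff _ _ _ _ _ (U f) _ _ _ hind]
    intro s
    rw [Metric.equicontinuousAt_iff_right]
    intro ε hε
    filter_upwards [hP f s ε hε] with t ht i
    exact ht _ (hF i)
  refine ArzelaAscoli.isCompact_of_equicontinuous _ ?_ ?_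
  -- Any function satisfying the bound is automatically continuous, so the image in the product
  -- space is cut out by closed pointwise conditions and is compact by Tychonoff.
  · have himage : ContinuousMap.toFun '' {η : C(X, ProbabilityMeasure E) | P η} = {η | P η} := by
      ext η
      refine ⟨?_, fun h => ⟨⟨η, ?_⟩, h, rfl⟩⟩
      · rintro ⟨η, h, rfl⟩; exact h
      · refine continuous_iff_continuousAt.2 fun s =>
          tendsto_of_forall_dense_integral_tendsto hD fun g hg => Metric.tendsto_nhds.2 fun ε hε => ?_
        filter_upwards [hP (CoreSpace.mk g hg) s ε hε] with t ht
        rw [dist_comm]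
        exact ht η h
    have hclosed : IsClosed {η : X → ProbabilityMeasure E | P η} := by
      simp only [P, ofPred_forall]
      refine isClosed_iInter fun c => isClosed_iInter fun f => isClosed_iInter fun _ =>
        isClosed_iInter fun s => isClosed_iInter fun t => isClosed_le (continuous_const.mul
          (Continuous.dist ?_ ?_)) continuous_const
      · exact (continuous_integral_right (incl f)).comp (continuous_apply s)
      · exact (continuous_integral_right (incl f)).comp (continuous_apply t)
    exact himage ▸ hclosed.isCompact
  · exact hequi _ fun η => η.2

end Compactness

end PathLD

/-! ### Compactness of the level sets -/

theorem mainTheorem4 {E : Type*} [MetricSpace E] [CompactSpace E] [MeasurableSpace E]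
    [BorelSpace E] (S : PathLD.FellerSemigroup E) (D : Submodule ℝ C(E, ℝ))
    [TopologicalSpace (PathLD.CoreSpace D)] [IsTopologicalAddGroup (PathLD.CoreSpace D)]
    [ContinuousSMul ℝ (PathLD.CoreSpace D)] [LocallyConvexSpace ℝ (PathLD.CoreSpace D)]
    [T2Space (PathLD.CoreSpace D)] [TopologicalSpace.SeparableSpace (PathLD.CoreSpace D)]
    [BarrelledSpace ℝ (PathLD.CoreSpace D)] (hD : PathLD.IsRegularCore S D)
    (M : ℝ) (hM : 0 < M) (T : ℝ≥0) :
    IsCompact ((fun ν : C(ℝ≥0, ProbabilityMeasure E) => ν.restrict (Set.Icc 0 T)) ''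
      PathLD.levelSet S D M T) := by
  refine (PathLD.isCompact_setOf_dist_integral_le hD.dense M
    (PathLD.hamiltonianBound S)).of_isClosed_subset (IsSeqClosed.isClosed ?_) ?_
  · intro ηs η hηs hlim
    choose νs hνs hνη using hηs
    have hT : (0 : ℝ≥0) ≤ T := zero_le
    -- The limit lives on `[0, T]` only; it is extended to rest at its final value.
    let ν : C(ℝ≥0, ProbabilityMeasure E) := η.comp ⟨projIcc 0 T hT, continuous_projIcc⟩
    have hν : ∀ t : Icc 0 T, ν t = η t := fun t => congrArg η (projIcc_val hT t)
    refine ⟨ν, hD.mem_levelSet_of_tendsto hM.le hνs (fun t ht => ?_) (fun t ht => ?_),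
      ContinuousMap.ext hν⟩
    · rw [hν ⟨t, zero_le, ht⟩]
      have h1 := ((continuous_eval_const (⟨t, zero_le, ht⟩ : Icc 0 T)).tendsto η).comp hlim
      refine h1.congr fun n => ?_
      rw [Function.comp_apply, ← hνη n]
      rfl
    · exact congrArg η ((projIcc_of_right_le hT ht).trans (projIcc_right hT).symm)
  · rintro _ ⟨ν, hν, rfl⟩ c f hc s t
    have hmem : ∀ r : Icc 0 T, ((r : ℝ≥0) : ℝ) ∈ uIcc 0 (T : ℝ) := fun r => by
      rw [uIcc_of_le T.coe_nonneg]
      exact ⟨NNReal.coe_nonneg _, NNReal.coe_le_coe.2 r.2.2⟩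
    -- The family consisting of a single interval with endpoints `s` and `t`.
    have h := PathLD.sum_dist_integral_le hM.le hν hc f
      (I := (1, fun _ => (((s : ℝ≥0) : ℝ), ((t : ℝ≥0) : ℝ))))
      ⟨fun _ _ => ⟨hmem s, hmem t⟩, by simp⟩
    simpa [Subtype.dist_eq, NNReal.dist_eq, Real.dist_eq] using h
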